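/- Let $d \ge 2$, let $\mathcal{H}_1,\dots,\mathcal{H}_d$ be real separable Hilbert spaces, and let $\mathcal{H} = \mathcal{H}_1\otimes\cdots\otimes\mathcal{H}_d$ be their Hilbert space tensor product. Let $\mathbb{T}$ be a binary dimension tree with root $\{1,\dots,d\}$: its nodes are subsets of $\{1,\dots,d\}$, its leaves are singletons, and every other node is the disjoint union of its two sons. For $n\subseteq\{1,\dots,d\}$ put $[n] = \{1,\dots,d\}\setminus n$, and let $\{n_t,[n_t]\}$, $t=1,\dots,E$, be an enumeration of the set of edges $\{\{n,[n]\} : n\in\mathbb{T}\setminus\{\{1,\dots,d\}\}\}$. For $\mathbf{u}\in\mathcal{H}$ let $$\mathcal{M}_t(\mathbf{u}) : \bigotimes_{i\in[n_t]}\mathcal{H}_i \to \bigotimes_{i\in n_t}\mathcal{H}_i$$ be its $t$-th matricization, that is, the Hilbert--Schmidt operator with $\langle \mathcal{M}_t(\mathbf{u})a, b\rangle = \langle \mathbf{u}, b\otimes a\rangle$ for all $a,b$, and let $\sigma_{t,1}(\mathbf{u})\ge\sigma_{t,2}(\mathbf{u})\ge\dots\ge 0$ be its singular values, counted with multiplicity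 and extended by zero to a sequence on $\mathbb{N}$. For $\alpha\ge 0$ let $s_\alpha(x) = \operatorname{sgn}(x)\max\{|x|-\alpha,0\}$; for an operator with singular value decomposition $X=\sum_k\sigma_k\langle v_k,\cdot\rangle w_k$ let $S_\alpha(X)=\sum_k s_\alpha(\sigma_k)\langle v_k,\cdot\rangle w_k$; and let $S_{t,\alpha} = \mathcal{M}_t^{-1}\circ S_\alpha\circ\mathcal{M}_t : \mathcal{H}\to\mathcal{H}$ be soft thresholding of the $t$-th matricization. Then for all $\mathbf{u}\in\mathcal{H}$, all $s,t\in\{1,\dots,E\}$, all $\alpha\ge 0$ and all $i\in\mathbb{N}$, $$\sigma_{t,i}(\mathbf{u}) \ge \sigma_{t,i}\bigl(S_{s,\alpha}(\mathbf{u})\bigr).$$ -/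

import Mathlib

noncomputable section

set_option linter.unusedSectionVars false

open scoped TensorProduct InnerProductSpace
open Filter Topology

section SVD

variable {E F : Type*} [NormedAddCommGroup E] [InnerProductSpace ℝ E]
  [NormedAddCommGroup F] [InnerProductSpace ℝ F]

/-- A singular value decomposition `X = ∑ k, σ k ⟪right k, ·⟫ left k` of an operator between real
inner product spaces, with the singular values enumerated (from index `0`) in non-increasing order
with multiplicity, and extended by zero if there are only finitely many. The left and right singular
vectors that belong to nonzero singular values form orthonormal systems; those that belong to the
singular value `0` do not contribute and are arbitrary. The series converges in operator norm. -/
structure SVD (X : E →L[ℝ] F) where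
  σ : ℕ → ℝ
  left : ℕ → F
  right : ℕ → E
  nonneg : ∀ k, 0 ≤ σ k
  antitone : Antitone σ
  orthonormal_left : Orthonormal ℝ (fun k : {k // σ k ≠ 0} => left k)
  orthonormal_right : Orthonormal ℝ (fun k : {k // σ k ≠ 0} => right k)
  hasSum : HasSum (fun k => σ k • InnerProductSpace.rankOne ℝ (left k) (right k)) X

namespace SVD

variable [CompleteSpace E] [CompleteSpace F]

theorem exists_max (X : E →L[ℝ] F) (hX : IsCompactOperator X) (h0 : X ≠ 0) :
    ∃ v : E, ‖v‖ = 1 ∧ ∀ y, ⟪X v, X y⟫_ℝ = ‖X‖ ^ 2 * ⟪v, y⟫_ℝ := by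
  set M := ‖X‖ with hM
  have hMpos : 0 < M := norm_pos_iff.2 h0
  let A := ContinuousLinearMap.adjoint X
  have hA : ‖A‖ = M := by simp [A, hM]
  have ex : ∀ n : ℕ, ∃ x, ‖x‖ < 1 ∧ M - 1 / ((n : ℝ) + 1) < ‖X x‖ := fun n =>
    ContinuousLinearMap.exists_lt_apply_of_lt_opNorm X (by
      have : 0 < 1 / ((n : ℝ) + 1) := by positivity
      linarith)
  choose x hx1 hx2 using ex
  have hxM : ∀ n, ‖X (x n)‖ ≤ M := fun n =>
    (X.le_opNorm _).trans (by nlinarith [hx1 n])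
  have hlim : Tendsto (fun n => ‖X (x n)‖) atTop (𝓝 M) := by
    refine tendsto_of_tendsto_of_tendsto_of_le_of_le (g := fun n : ℕ => M - 1 / ((n : ℝ) + 1))
      ?_ tendsto_const_nhds (fun n => (hx2 n).le) hxM
    simpa using tendsto_const_nhds.sub (tendsto_one_div_add_atTop_nhds_zero_nat (𝕜 := ℝ))
  have hdiff : ∀ n, ‖A (X (x n)) - M ^ 2 • x n‖ ^ 2 ≤ M ^ 2 * (M ^ 2 - ‖X (x n)‖ ^ 2) := by
    intro n
    rw [norm_sub_sq_real, real_inner_smul_right, ContinuousLinearMap.adjoint_inner_left,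
      real_inner_self_eq_norm_sq, norm_smul, Real.norm_of_nonneg (by positivity)]
    have h1 : ‖A (X (x n))‖ ≤ M * ‖X (x n)‖ := hA ▸ A.le_opNorm _
    have h2 : ‖A (X (x n))‖ ^ 2 ≤ M ^ 2 * ‖X (x n)‖ ^ 2 := by
      rw [← mul_pow]; exact pow_le_pow_left₀ (norm_nonneg _) h1 2
    have h3 : (M ^ 2 * ‖x n‖) ^ 2 ≤ M ^ 2 * M ^ 2 := by
      have : M ^ 2 * ‖x n‖ ≤ M ^ 2 := mul_le_of_le_one_right (by positivity) (hx1 n).le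
      calc (M ^ 2 * ‖x n‖) ^ 2 ≤ (M ^ 2) ^ 2 := pow_le_pow_left₀ (by positivity) this 2
        _ = _ := by ring
    nlinarith
  have hzero : Tendsto (fun n => A (X (x n)) - M ^ 2 • x n) atTop (𝓝 0) := by
    rw [tendsto_zero_iff_norm_tendsto_zero]
    have : Tendsto (fun n => ‖A (X (x n)) - M ^ 2 • x n‖ ^ 2) atTop (𝓝 0) := by
      refine squeeze_zero (fun n => by positivity) hdiff ?_
      have := ((tendsto_const_nhds (x := M ^ 2)).sub (hlim.pow 2)).const_mul (M ^ 2)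
      simpa using this
    simpa using this.sqrt
  obtain ⟨K, hK, hsub⟩ := hX.image_closedBall_subset_compact (𝕜₁ := ℝ) (f := X.toLinearMap) 1
  obtain ⟨y, -, φ, hφ, hy⟩ := hK.tendsto_subseq
    (x := fun n => X (x n)) (fun n => hsub ⟨x n, by simpa using (hx1 n).le, rfl⟩)
  have hv : Tendsto (fun n => x (φ n)) atTop (𝓝 ((M ^ 2)⁻¹ • A y)) := by
    have h1 : Tendsto (fun n => A (X (x (φ n)))) atTop (𝓝 (A y)) :=
      (A.continuous.tendsto y).comp hy
    have h2 := (h1.sub (hzero.comp hφ.tendsto_atTop)).const_smul (M ^ 2)⁻¹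
    simp only [Function.comp_def, sub_sub_cancel, sub_zero] at h2
    refine h2.congr fun n => ?_
    rw [smul_smul, inv_mul_cancel₀ (by positivity), one_smul]
  set v := (M ^ 2)⁻¹ • A y with hvdef
  have hXv : Tendsto (fun n => X (x (φ n))) atTop (𝓝 (X v)) := (X.continuous.tendsto v).comp hv
  have hnXv : ‖X v‖ = M := tendsto_nhds_unique hXv.norm (hlim.comp hφ.tendsto_atTop)
  have hv1 : ‖v‖ ≤ 1 := le_of_tendsto' hv.norm fun n => (hx1 _).le
  have hv2 : 1 ≤ ‖v‖ := by
    have := X.le_opNorm v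
    rw [hnXv, ← hM] at this
    nlinarith
  have heq : A (X v) = M ^ 2 • v := by
    have h1 : Tendsto (fun n => A (X (x (φ n))) - M ^ 2 • x (φ n)) atTop
        (𝓝 (A (X v) - M ^ 2 • v)) :=
      ((A.continuous.tendsto _).comp hXv).sub (hv.const_smul _)
    exact sub_eq_zero.1 (tendsto_nhds_unique h1 (hzero.comp hφ.tendsto_atTop))
  refine ⟨v, le_antisymm hv1 hv2, fun y => ?_⟩
  rw [← ContinuousLinearMap.adjoint_inner_left, show ContinuousLinearMap.adjoint X (X v) = _ from heq,
    real_inner_smul_left]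

open Classical in
/-- Auxiliary for the existence of singular value decompositions: a maximizing vector. -/
def pick (X : E →L[ℝ] F) : E :=
  if h : ∃ v : E, ‖v‖ = 1 ∧ ∀ y, ⟪X v, X y⟫_ℝ = ‖X‖ ^ 2 * ⟪v, y⟫_ℝ then h.choose else 0

/-- Auxiliary for the existence of singular value decompositions: successive deflation. -/
def deflate (X : E →L[ℝ] F) : ℕ → (E →L[ℝ] F)
  | 0 => X
  | k + 1 => deflate X k - InnerProductSpace.rankOne ℝ (deflate X k (pick (deflate X k)))
      (pick (deflate X k))

/-- Every compact operator between real Hilbert spaces has a singular value decomposition. -/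
theorem nonempty_of_isCompactOperator (X : E →L[ℝ] F) (hX : IsCompactOperator X) :
    Nonempty (SVD X) := by
  set Y := deflate X with hY
  set v : ℕ → E := fun k => pick (Y k) with hv
  have hsucc : ∀ k x, Y (k + 1) x = Y k x - ⟪v k, x⟫_ℝ • Y k (v k) := fun k x => by
    simp [hY, deflate, hv]
  have hsucc' : ∀ k x, Y (k + 1) x = Y k (x - ⟪v k, x⟫_ℝ • v k) := fun k x => by
    simp [hsucc]
  have hcpt : ∀ k, IsCompactOperator (Y k) := by
    intro k
    induction k with
    | zero => exact hX
    | succ k ih =>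
      have h : (Y (k + 1) : E → F) =
          (Y k) ∘ (ContinuousLinearMap.id ℝ E - InnerProductSpace.rankOne ℝ (v k) (v k)) := by
        ext x; simp [hsucc']
      rw [h]
      exact ih.comp_clm _
  have hpick : ∀ k, Y k ≠ 0 → ‖v k‖ = 1 ∧ ∀ y, ⟪Y k (v k), Y k y⟫_ℝ = ‖Y k‖ ^ 2 * ⟪v k, y⟫_ℝ := by
    intro k hk
    have h := exists_max (Y k) (hcpt k) hk
    have : v k = h.choose := by simp only [hv, pick, dif_pos h]
    rw [this]; exact h.choose_spec
  have hself : ∀ k, Y (k + 1) (v k) = 0 := by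
    intro k
    by_cases hk : Y k = 0
    · simp [hsucc, hk]
    · simp [hsucc, (hpick k hk).1]
  have hker : ∀ j k, j < k → Y k (v j) = 0 := by
    intro j k hjk
    induction k, hjk using Nat.le_induction with
    | base => exact hself j
    | succ k hk ih =>
      by_cases hk0 : Y k = 0
      · simp [hsucc, hk0]
      · have h := (hpick k hk0).2 (v j)
        rw [ih, inner_zero_right] at h
        have hn : ‖Y k‖ ^ 2 ≠ 0 := pow_ne_zero _ (norm_ne_zero_iff.2 hk0)
        have h' : ⟪v k, v j⟫_ℝ = 0 := by
          rcases mul_eq_zero.1 h.symm with h | h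
          · exact absurd h hn
          · exact h
        simp [hsucc, ih, h']
  have hvorth : ∀ j k, j < k → Y k ≠ 0 → ⟪v k, v j⟫_ℝ = 0 := by
    intro j k hjk hk0
    have h := (hpick k hk0).2 (v j)
    rw [hker j k hjk, inner_zero_right] at h
    have hn : ‖Y k‖ ^ 2 ≠ 0 := pow_ne_zero _ (norm_ne_zero_iff.2 hk0)
    rcases mul_eq_zero.1 h.symm with h | h
    · exact absurd h hn
    · exact h
  have hrange : ∀ j k, j < k → ∀ x, ⟪Y j (v j), Y k x⟫_ℝ = 0 := by
    intro j k hjk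
    induction k, hjk using Nat.le_induction with
    | base =>
      intro x
      by_cases hj : Y j = 0
      · simp [hj]
      · rw [hsucc', (hpick j hj).2]
        simp [inner_sub_right, real_inner_smul_right, (hpick j hj).1]
    | succ k hk ih => intro x; rw [hsucc']; exact ih _
  have hnorm : ∀ k, ‖Y k (v k)‖ = ‖Y k‖ := by
    intro k
    by_cases hk : Y k = 0
    · simp [hk]
    · have h := (hpick k hk).2 (v k)
      rw [real_inner_self_eq_norm_sq, real_inner_self_eq_norm_sq, (hpick k hk).1] at h
      rw [← sq_eq_sq₀ (norm_nonneg _) (norm_nonneg _), h]; ring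
  have hanti : Antitone fun k => ‖Y k‖ := by
    refine antitone_nat_of_succ_le fun k => ?_
    refine ContinuousLinearMap.opNorm_le_bound _ (norm_nonneg _) fun x => ?_
    by_cases hk : Y k = 0
    · simp [hsucc, hk]
    · rw [hsucc']
      refine (ContinuousLinearMap.le_opNorm _ _).trans ?_
      refine mul_le_mul_of_nonneg_left ?_ (norm_nonneg _)
      rw [← sq_le_sq₀ (norm_nonneg _) (norm_nonneg _), norm_sub_sq_real, real_inner_smul_right,
        norm_smul, (hpick k hk).1, real_inner_comm, mul_one, Real.norm_eq_abs, sq_abs]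
      nlinarith [sq_nonneg ⟪v k, x⟫_ℝ]
  have hXv : ∀ k, Y k ≠ 0 → Y k (v k) = X (v k) := by
    intro k hk
    have : ∀ j, j ≤ k → Y j (v k) = X (v k) := by
      intro j
      induction j with
      | zero => intro _; rfl
      | succ j ih =>
        intro hj
        rw [hsucc, ih (by omega), real_inner_comm, hvorth j k (by omega) hk]; simp
    exact this k le_rfl
  have hzero : ∀ ε > 0, ∃ N, ‖Y N‖ < ε := by
    intro ε hε
    by_contra! hcon
    have hne : ∀ k, Y k ≠ 0 := fun k h => by have := hcon k; simp [h] at this; linarith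
    obtain ⟨K, hK, hsub⟩ := hX.image_closedBall_subset_compact (𝕜₁ := ℝ) (f := X.toLinearMap) 1
    obtain ⟨y, -, φ, hφ, hy⟩ := hK.tendsto_subseq
      (x := fun n => X (v n)) (fun n => hsub ⟨v n, by simp [(hpick n (hne n)).1], rfl⟩)
    obtain ⟨N, hN⟩ := Metric.cauchySeq_iff.1 hy.cauchySeq ε hε
    have h1 := hN N le_rfl (N + 1) (by omega)
    have h2 : ⟪X (v (φ N)), X (v (φ (N + 1)))⟫_ℝ = 0 := by
      rw [← hXv _ (hne _), ← hXv _ (hne _)]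
      exact hrange _ _ (hφ (by omega)) _
    rw [Function.comp_apply, Function.comp_apply, dist_eq_norm] at h1
    have h3 : ‖X (v (φ N))‖ ^ 2 ≤ ‖X (v (φ N)) - X (v (φ (N + 1)))‖ ^ 2 := by
      rw [norm_sub_sq_real, h2]; nlinarith [sq_nonneg ‖X (v (φ (N + 1)))‖]
    have h4 : ε ≤ ‖X (v (φ N))‖ := by
      rw [← hXv _ (hne _), hnorm]; exact hcon _
    nlinarith [norm_nonneg (X (v (φ N)) - X (v (φ (N + 1))))]
  set w : ℕ → F := fun k => (‖Y k‖)⁻¹ • Y k (v k) with hw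
  have hYw : ∀ k, ‖Y k‖ • w k = Y k (v k) := by
    intro k
    by_cases hk : Y k = 0
    · simp [hk]
    · rw [hw, smul_smul, mul_inv_cancel₀ (norm_ne_zero_iff.2 hk), one_smul]
  have hpartial : ∀ N, ∑ k ∈ Finset.range N, ‖Y k‖ • InnerProductSpace.rankOne ℝ (w k) (v k)
      = X - Y N := by
    intro N
    induction N with
    | zero => simp [hY, deflate]
    | succ N ih =>
      rw [Finset.sum_range_succ, ih]
      ext x
      simp only [add_apply, sub_apply, hsucc,
        smul_apply, InnerProductSpace.rankOne_apply]
      rw [smul_comm, hYw]; abel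
  have hov : Orthonormal ℝ (fun k : {k // ‖Y k‖ ≠ 0} => v k) := by
    refine ⟨fun k => (hpick k (norm_ne_zero_iff.1 k.2)).1, fun j k hjk => ?_⟩
    rcases lt_or_gt_of_ne (fun h => hjk (Subtype.ext h)) with h | h
    · rw [real_inner_comm]; exact hvorth _ _ h (norm_ne_zero_iff.1 k.2)
    · exact hvorth _ _ h (norm_ne_zero_iff.1 j.2)
  have how : Orthonormal ℝ (fun k : {k // ‖Y k‖ ≠ 0} => w k) := by
    refine ⟨fun k => ?_, fun j k hjk => ?_⟩
    · simp only [hw, norm_smul, hnorm, norm_inv, norm_norm]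
      exact inv_mul_cancel₀ k.2
    · simp only [hw, real_inner_smul_left, real_inner_smul_right]
      rcases lt_or_gt_of_ne (fun h => hjk (Subtype.ext h)) with h | h
      · rw [hrange _ _ h]; simp
      · rw [real_inner_comm, hrange _ _ h]; simp
  have hbound : ∀ (N : ℕ) (t : Finset ℕ), Disjoint t (Finset.range N) →
      ‖∑ k ∈ t, ‖Y k‖ • InnerProductSpace.rankOne ℝ (w k) (v k)‖ ≤ ‖Y N‖ := by
    intro N t ht
    refine ContinuousLinearMap.opNorm_le_bound _ (norm_nonneg _) fun x => ?_
    have e1 : (∑ k ∈ t, ‖Y k‖ • InnerProductSpace.rankOne ℝ (w k) (v k)) x =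
        ∑ k ∈ t.subtype (fun k => ‖Y k‖ ≠ 0), (‖Y k‖ * ⟪v k, x⟫_ℝ) • w k := by
      rw [Finset.sum_subtype_eq_sum_filter (s := t) (p := fun k => ‖Y k‖ ≠ 0)
        (fun k => (‖Y k‖ * ⟪v k, x⟫_ℝ) • w k), Finset.sum_filter_of_ne]
      · simp [mul_smul]
      · intro k _ h h0; simp [h0] at h
    rw [e1, ← sq_le_sq₀ (norm_nonneg _) (by positivity), ← real_inner_self_eq_norm_sq,
      how.inner_sum]
    calc _ ≤ ∑ k ∈ t.subtype (fun k => ‖Y k‖ ≠ 0), ‖Y N‖ ^ 2 * ‖⟪v k, x⟫_ℝ‖ ^ 2 := by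
          refine Finset.sum_le_sum fun k hk => ?_
          have hNk : N ≤ (k : ℕ) := by
            by_contra hlt
            exact Finset.disjoint_left.1 ht (Finset.mem_subtype.1 hk)
              (Finset.mem_range.2 (not_le.1 hlt))
          have : ‖Y k‖ ^ 2 ≤ ‖Y N‖ ^ 2 := pow_le_pow_left₀ (norm_nonneg _) (hanti hNk) 2
          simp only [conj_trivial, Real.norm_eq_abs, sq_abs]
          nlinarith [sq_nonneg ⟪v k, x⟫_ℝ]
      _ ≤ ‖Y N‖ ^ 2 * ‖x‖ ^ 2 := by
          rw [← Finset.mul_sum]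
          exact mul_le_mul_of_nonneg_left (hov.sum_inner_products_le x) (by positivity)
      _ = _ := by ring
  have hsum : Summable fun k => ‖Y k‖ • InnerProductSpace.rankOne ℝ (w k) (v k) := by
    rw [summable_iff_vanishing_norm]
    intro ε hε
    obtain ⟨N, hN⟩ := hzero ε hε
    exact ⟨Finset.range N, fun t ht => (hbound N t ht).trans_lt hN⟩
  have hYlim : Tendsto Y atTop (𝓝 0) := by
    rw [tendsto_zero_iff_norm_tendsto_zero, Metric.tendsto_atTop]
    intro ε hε
    obtain ⟨N, hN⟩ := hzero ε hε
    exact ⟨N, fun k hk => by simpa using (hanti hk).trans_lt hN⟩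
  have hlim : Tendsto (fun N => ∑ k ∈ Finset.range N,
      ‖Y k‖ • InnerProductSpace.rankOne ℝ (w k) (v k)) atTop (𝓝 X) := by
    simp only [hpartial]
    simpa using tendsto_const_nhds.sub hYlim
  have htsum := tendsto_nhds_unique hsum.hasSum.tendsto_sum_nat hlim
  exact ⟨⟨fun k => ‖Y k‖, w, v, fun k => norm_nonneg _, hanti, how, hov, htsum ▸ hsum.hasSum⟩⟩

end SVD

/-- Soft thresholding of a real number, `s_α(x) = sgn(x) max(|x| - α, 0)`. -/
def softThresholdReal (α x : ℝ) : ℝ := Real.sign x * max (|x| - α) 0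

open Classical in
/-- The sequence of singular values of `X`, in non-increasing order and with multiplicity. It does
not depend on the chosen singular value decomposition; the default `0` is used only for operators
without such a decomposition, which are never compact. -/
def singularValue (X : E →L[ℝ] F) : ℕ → ℝ :=
  if h : Nonempty (SVD X) then h.some.σ else 0

open Classical in
/-- Soft thresholding of the singular values of an operator: if `X = ∑ k, σ k ⟪v k, ·⟫ w k` is a
singular value decomposition, then the result is `∑ k, s_α(σ k) ⟪v k, ·⟫ w k`. It does not depend on
the chosen singular value decomposition. For `α > 0` only finitely many terms are nonzero. -/
def softThresholdOp (α : ℝ) (X : E →L[ℝ] F) : E →L[ℝ] F :=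
  if h : Nonempty (SVD X) then
    ∑' k, softThresholdReal α (h.some.σ k) •
      InnerProductSpace.rankOne ℝ (h.some.left k) (h.some.right k)
  else 0

end SVD

/-- The algebraic tensor product of the real vector spaces `H i`. It is a type synonym of
`PiTensorProduct`, because the latter already carries the projective seminorm, whereas here we want
the canonical (Hilbert) cross norm. -/
def AlgTensor {ι : Type*} (H : ι → Type*) [∀ i, NormedAddCommGroup (H i)]
    [∀ i, InnerProductSpace ℝ (H i)] : Type _ :=
  ⨂[ℝ] i, H i

namespace AlgTensor

variable {ι : Type*} (H : ι → Type*) [∀ i, NormedAddCommGroup (H i)]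
  [∀ i, InnerProductSpace ℝ (H i)]

instance : AddCommGroup (AlgTensor H) := inferInstanceAs (AddCommGroup (⨂[ℝ] i, H i))
instance : Module ℝ (AlgTensor H) := inferInstanceAs (Module ℝ (⨂[ℝ] i, H i))

/-- The elementary tensor of a family of vectors, in the algebraic tensor product. -/
def tprod : MultilinearMap ℝ H (AlgTensor H) := PiTensorProduct.tprod ℝ

variable {H} in
/-- The universal property of the algebraic tensor product. -/
def lift {G : Type*} [AddCommGroup G] [Module ℝ G] (f : MultilinearMap ℝ H G) :
    AlgTensor H →ₗ[ℝ] G := PiTensorProduct.lift f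

variable {H} in
@[simp] theorem lift_tprod {G : Type*} [AddCommGroup G] [Module ℝ G] (f : MultilinearMap ℝ H G)
    (x : ∀ i, H i) : lift f (tprod H x) = f x := PiTensorProduct.lift.tprod x

theorem span_tprod : Submodule.span ℝ (Set.range (tprod H)) = ⊤ :=
  PiTensorProduct.span_tprod_eq_top

variable {H} in
theorem exists_sum (z : AlgTensor H) :
    ∃ (N : ℕ) (c : Fin N → ℝ) (x : Fin N → ∀ i, H i), z = ∑ a, c a • tprod H (x a) := by
  have hz : z ∈ Submodule.span ℝ (Set.range (tprod H)) := by rw [span_tprod]; trivial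
  obtain ⟨N, c, g, h⟩ := Submodule.mem_span_set'.1 hz
  choose x hx using fun a => (g a).2
  exact ⟨N, c, x, by simp [hx, ← h]⟩

variable [Fintype ι]

/-- The bilinear form with `⟨⊗ x i, ⊗ y i⟩ = ∏ ⟨x i, y i⟩`. -/
def innerForm : AlgTensor H →ₗ[ℝ] AlgTensor H →ₗ[ℝ] ℝ :=
  LinearMap.compr₂ (PiTensorProduct.map₂ (fun i => innerₗ (H i)))
    (PiTensorProduct.constantBaseRingEquiv ι ℝ).toLinearMap

variable {H} in
@[simp] theorem innerForm_tprod (x y : ∀ i, H i) :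
    innerForm H (tprod H x) (tprod H y) = ∏ i, ⟪x i, y i⟫_ℝ := by
  have h := PiTensorProduct.map₂_tprod_tprod (R := ℝ) (fun i => innerₗ (H i)) x y
  have h2 := PiTensorProduct.constantBaseRingEquiv_tprod (R := ℝ)
    (fun i => ⟪x i, y i⟫_ℝ)
  unfold innerForm tprod
  erw [LinearMap.compr₂_apply, h]
  exact h2

theorem innerForm_symm (x y : AlgTensor H) : innerForm H x y = innerForm H y x := by
  obtain ⟨N, c, a, rfl⟩ := exists_sum x
  obtain ⟨M, e, b, rfl⟩ := exists_sum y
  simp only [map_sum, map_smul, LinearMap.sum_apply, LinearMap.smul_apply, innerForm_tprod,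
    smul_eq_mul, Finset.mul_sum]
  rw [Finset.sum_comm]
  refine Finset.sum_congr rfl fun i _ => Finset.sum_congr rfl fun j _ => ?_
  rw [Finset.prod_congr rfl fun k _ => real_inner_comm _ _]
  ring

theorem innerForm_nonneg (x : AlgTensor H) : 0 ≤ innerForm H x x := by
  obtain ⟨N, c, a, rfl⟩ := exists_sum x
  have key : ∀ s : Finset ι,
      (Matrix.of fun k l : Fin N => ∏ i ∈ s, ⟪a k i, a l i⟫_ℝ).PosSemidef := by
    classical
    intro s
    induction s using Finset.induction_on with
    | empty =>
      have := Matrix.posSemidef_gram ℝ (fun _ : Fin N => (1 : ℝ))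
      have e : (Matrix.of fun k l : Fin N => ∏ i ∈ (∅ : Finset ι), ⟪a k i, a l i⟫_ℝ) =
          Matrix.gram ℝ (fun _ : Fin N => (1 : ℝ)) := by
        ext k l; simp [Matrix.gram]
      rw [e]; exact this
    | insert i s hi ih =>
      have := (Matrix.posSemidef_gram ℝ (fun k : Fin N => a k i)).hadamard ih
      have e : (Matrix.of fun k l : Fin N => ∏ i ∈ insert i s, ⟪a k i, a l i⟫_ℝ) =
          (Matrix.gram ℝ fun k : Fin N => a k i).hadamard
            (Matrix.of fun k l => ∏ i ∈ s, ⟪a k i, a l i⟫_ℝ) := by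
        ext k l; simp [Matrix.gram, Matrix.hadamard, Finset.prod_insert hi]
      rw [e]; exact this
  have := (key Finset.univ).dotProduct_mulVec_nonneg c
  refine this.trans_eq ?_
  simp only [map_sum, map_smul, LinearMap.sum_apply, LinearMap.smul_apply, innerForm_tprod,
    smul_eq_mul, Matrix.mulVec, dotProduct, Matrix.of_apply, star_trivial, Finset.mul_sum]
  rw [Finset.sum_comm]
  refine Finset.sum_congr rfl fun i _ => Finset.sum_congr rfl fun j _ => ?_
  rw [Finset.prod_congr rfl fun k _ => real_inner_comm _ _]
  ring

/-- The canonical inner product on the algebraic tensor product. -/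
abbrev core : PreInnerProductSpace.Core ℝ (AlgTensor H) where
  inner x y := innerForm H x y
  conj_inner_symm x y := by simpa using innerForm_symm H y x
  re_inner_nonneg x := by simpa using innerForm_nonneg H x
  add_left x y z := by simp
  smul_left x y r := by simp

instance : SeminormedAddCommGroup (AlgTensor H) :=
  @InnerProductSpace.Core.toSeminormedAddCommGroup ℝ _ _ _ _ (core H)

instance : InnerProductSpace ℝ (AlgTensor H) := InnerProductSpace.ofCore (core H)

variable {H} in
theorem inner_tprod (x y : ∀ i, H i) :
    ⟪tprod H x, tprod H y⟫_ℝ = ∏ i, ⟪x i, y i⟫_ℝ := innerForm_tprod x y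

end AlgTensor

/-- The Hilbert space tensor product of the real Hilbert spaces `H i`: the completion of the
algebraic tensor product for the inner product with `⟪⨂ x i, ⨂ y i⟫ = ∏ i, ⟪x i, y i⟫`. -/
abbrev HilbertTensor {ι : Type*} [Fintype ι] (H : ι → Type*) [∀ i, NormedAddCommGroup (H i)]
    [∀ i, InnerProductSpace ℝ (H i)] : Type _ :=
  UniformSpace.Completion (AlgTensor H)

namespace HilbertTensor

variable {ι : Type*} [Fintype ι] [DecidableEq ι] (H : ι → Type*) [∀ i, NormedAddCommGroup (H i)]
  [∀ i, InnerProductSpace ℝ (H i)]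

variable {H} in
/-- The elementary tensor `⨂ x i` in the Hilbert tensor product. -/
def elem (x : ∀ i, H i) : HilbertTensor H := (AlgTensor.tprod H x : AlgTensor H)

/-- The partial tensor product over the modes in `n`. -/
abbrev Part (n : Finset ι) : Type _ := HilbertTensor (fun i : {i // i ∈ n} => H i)
/-- The partial tensor product over the modes in the complement of `n`. -/
abbrev CoPart (n : Finset ι) : Type _ := HilbertTensor (fun i : {i // i ∉ n} => H i)

/-- The canonical bilinear map sending two algebraic tensors, over the modes in `n` and over the
modes outside `n`, to their tensor product. -/
def mergeAlg (n : Finset ι) : AlgTensor (fun i : {i // i ∈ n} => H i) →ₗ[ℝ]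
    AlgTensor (fun i : {i // i ∉ n} => H i) →ₗ[ℝ] AlgTensor H :=
  LinearMap.flip <| AlgTensor.lift <|
    (LinearMap.compMultilinearMap
      { toFun := fun f => AlgTensor.lift f
        map_add' := fun f g => map_add PiTensorProduct.lift f g
        map_smul' := fun r f => map_smul PiTensorProduct.lift r f }
      ((AlgTensor.tprod H).domDomRestrictₗ (fun i => i ∈ n)))

theorem mergeAlg_tprod (n : Finset ι) (x : ∀ i : {i // i ∈ n}, H i) (y : ∀ i : {i // i ∉ n}, H i) :
    mergeAlg H n (AlgTensor.tprod _ x) (AlgTensor.tprod _ y) =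
      AlgTensor.tprod H (fun i => if h : i ∈ n then x ⟨i, h⟩ else y ⟨i, h⟩) := by
  have h1 : mergeAlg H n (AlgTensor.tprod _ x) (AlgTensor.tprod _ y) =
      AlgTensor.lift ((AlgTensor.tprod H).domDomRestrict (fun i => i ∈ n) y)
        (AlgTensor.tprod _ x) := by
    rw [mergeAlg, LinearMap.flip_apply, AlgTensor.lift_tprod]; rfl
  rw [h1, AlgTensor.lift_tprod, MultilinearMap.domDomRestrict_apply]

theorem inner_mergeAlg (n : Finset ι) (a a' : AlgTensor (fun i : {i // i ∈ n} => H i))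
    (b b' : AlgTensor (fun i : {i // i ∉ n} => H i)) :
    ⟪mergeAlg H n a b, mergeAlg H n a' b'⟫_ℝ = ⟪a, a'⟫_ℝ * ⟪b, b'⟫_ℝ := by
  obtain ⟨N₁, c₁, x₁, rfl⟩ := AlgTensor.exists_sum a
  obtain ⟨N₂, c₂, x₂, rfl⟩ := AlgTensor.exists_sum a'
  obtain ⟨N₃, c₃, x₃, rfl⟩ := AlgTensor.exists_sum b
  obtain ⟨N₄, c₄, x₄, rfl⟩ := AlgTensor.exists_sum b'
  have key : ∀ i j k l, ⟪mergeAlg H n (AlgTensor.tprod _ (x₁ i)) (AlgTensor.tprod _ (x₃ j)),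
      mergeAlg H n (AlgTensor.tprod _ (x₂ k)) (AlgTensor.tprod _ (x₄ l))⟫_ℝ =
      ⟪AlgTensor.tprod _ (x₁ i), AlgTensor.tprod _ (x₂ k)⟫_ℝ *
      ⟪AlgTensor.tprod _ (x₃ j), AlgTensor.tprod _ (x₄ l)⟫_ℝ := by
    intro i j k l
    rw [mergeAlg_tprod, mergeAlg_tprod, AlgTensor.inner_tprod, AlgTensor.inner_tprod,
      AlgTensor.inner_tprod, ← Fintype.prod_subtype_mul_prod_subtype (fun i => i ∈ n)]
    congr 1
    · exact Finset.prod_congr (by ext; simp) fun i _ => by simp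
    · exact Finset.prod_congr rfl fun i _ => by simp [i.2]
  simp only [map_sum, map_smul, LinearMap.sum_apply, LinearMap.smul_apply, sum_inner, inner_sum,
    real_inner_smul_left, real_inner_smul_right, key, Finset.mul_sum, Finset.sum_mul]
  refine Finset.sum_congr rfl fun _ _ => Finset.sum_congr rfl fun _ _ =>
    Finset.sum_congr rfl fun _ _ => Finset.sum_congr rfl fun _ _ => ?_
  ring

theorem norm_mergeAlg (n : Finset ι) (a : AlgTensor (fun i : {i // i ∈ n} => H i))
    (b : AlgTensor (fun i : {i // i ∉ n} => H i)) :
    ‖mergeAlg H n a b‖ = ‖a‖ * ‖b‖ := by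
  rw [← sq_eq_sq₀ (norm_nonneg _) (by positivity), mul_pow, ← real_inner_self_eq_norm_sq,
    ← real_inner_self_eq_norm_sq, ← real_inner_self_eq_norm_sq, inner_mergeAlg]

/-- The map `mergeAlg` as a continuous bilinear map. -/
def mergePre (n : Finset ι) : AlgTensor (fun i : {i // i ∈ n} => H i) →L[ℝ]
    AlgTensor (fun i : {i // i ∉ n} => H i) →L[ℝ] HilbertTensor H :=
  LinearMap.mkContinuous₂
    ((mergeAlg H n).compr₂ (UniformSpace.Completion.toComplL (𝕜 := ℝ) (E := AlgTensor H)).toLinearMap)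
    1 (fun a b => by
      simp [norm_mergeAlg])

/-- The canonical continuous bilinear map `(b, a) ↦ b ⊗ a`, extended to the completions. -/
def mul (n : Finset ι) : Part H n →L[ℝ] CoPart H n →L[ℝ] HilbertTensor H :=
  ((((mergePre H n).extend UniformSpace.Completion.toComplL).flip).extend
    UniformSpace.Completion.toComplL).flip

theorem mul_coe (n : Finset ι) (a : AlgTensor (fun i : {i // i ∈ n} => H i))
    (b : AlgTensor (fun i : {i // i ∉ n} => H i)) :
    mul H n (a : Part H n) (b : CoPart H n) = (mergeAlg H n a b : AlgTensor H) := by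
  have h1 := ContinuousLinearMap.extend_eq (mergePre H n)
    (e := UniformSpace.Completion.toComplL)
    (UniformSpace.Completion.denseRange_coe) (UniformSpace.Completion.isUniformInducing_coe _) a
  have h2 := ContinuousLinearMap.extend_eq
    ((mergePre H n).extend (UniformSpace.Completion.toComplL (𝕜 := ℝ)
      (E := AlgTensor (fun i : {i // i ∈ n} => H i)))).flip
    (e := UniformSpace.Completion.toComplL)
    (UniformSpace.Completion.denseRange_coe) (UniformSpace.Completion.isUniformInducing_coe _) b
  simp only [UniformSpace.Completion.coe_toComplL] at h1 h2
  rw [mul, ContinuousLinearMap.flip_apply, h2, ContinuousLinearMap.flip_apply, h1]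
  rfl

theorem mul_elem (n : Finset ι) (x : ∀ i, H i) :
    mul H n (elem fun i => x i) (elem fun i => x i) = elem x := by
  rw [elem, elem, mul_coe, mergeAlg_tprod, elem]
  simp

/-- The matricization of a tensor `u` with respect to the modes in `n`: the operator `M` from the
tensor product over the complement of `n` to the tensor product over `n`, determined by
`⟪M a, b⟫ = ⟪u, b ⊗ a⟫` (see `inner_matricize`). It is linear and continuous in `u`, and
`b ⊗ a` is sent to the rank-one operator `⟪a, ·⟫ b` (see `matricize_mul`). -/
def matricize (n : Finset ι) : HilbertTensor H →L[ℝ] CoPart H n →L[ℝ] Part H n :=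
  LinearMap.mkContinuous₂
    (LinearMap.mk₂ ℝ
      (fun (u : HilbertTensor H) (a : CoPart H n) =>
        ContinuousLinearMap.adjoint ((mul H n).flip a) u)
      (fun u v a => by simp) (fun r u a => by simp) (fun u a b => by simp)
      (fun r u a => by simp))
    ‖(mul H n).flip‖ (fun u a => by
      have h1 := (ContinuousLinearMap.adjoint ((mul H n).flip a)).le_opNorm u
      have h2 := (mul H n).flip.le_opNorm a
      rw [LinearIsometryEquiv.norm_map] at h1
      simp only [LinearMap.mk₂_apply]
      nlinarith [norm_nonneg u])

theorem inner_matricize (n : Finset ι) (u : HilbertTensor H) (a : CoPart H n) (b : Part H n) :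
    ⟪matricize H n u a, b⟫_ℝ = ⟪u, mul H n b a⟫_ℝ := by
  simp [matricize, ContinuousLinearMap.adjoint_inner_left]

theorem inner_mul_mul (n : Finset ι) (b b' : Part H n) (a a' : CoPart H n) :
    ⟪mul H n b a, mul H n b' a'⟫_ℝ = ⟪b, b'⟫_ℝ * ⟪a, a'⟫_ℝ := by
  induction b using UniformSpace.Completion.induction_on with
  | hp => exact isClosed_eq (by fun_prop) (by fun_prop)
  | ih b =>
  induction b' using UniformSpace.Completion.induction_on with
  | hp => exact isClosed_eq (by fun_prop) (by fun_prop)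
  | ih b' =>
  induction a using UniformSpace.Completion.induction_on with
  | hp => exact isClosed_eq (by fun_prop) (by fun_prop)
  | ih a =>
  induction a' using UniformSpace.Completion.induction_on with
  | hp => exact isClosed_eq (by fun_prop) (by fun_prop)
  | ih a' =>
  simp only [mul_coe, UniformSpace.Completion.inner_coe, inner_mergeAlg]

theorem matricize_mul (n : Finset ι) (b : Part H n) (a : CoPart H n) :
    matricize H n (mul H n b a) = InnerProductSpace.rankOne ℝ b a := by
  ext a'
  refine ext_inner_right ℝ fun b' => ?_
  rw [inner_matricize, inner_mul_mul, InnerProductSpace.rankOne_apply, real_inner_smul_left]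
  ring

theorem dense_span_elem :
    Dense (Submodule.span ℝ (Set.range (elem : (∀ i, H i) → HilbertTensor H)) :
      Set (HilbertTensor H)) := by
  refine (UniformSpace.Completion.denseRange_coe (α := AlgTensor H)).mono ?_
  rintro _ ⟨z, rfl⟩
  obtain ⟨N, c, x, rfl⟩ := AlgTensor.exists_sum z
  have : ((∑ a, c a • AlgTensor.tprod H (x a) : AlgTensor H) : HilbertTensor H) =
      ∑ a, c a • elem (x a) := by
    rw [← UniformSpace.Completion.coe_toComplL (𝕜 := ℝ), map_sum]
    simp only [map_smul]; rfl
  rw [this]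
  exact Submodule.sum_mem _ fun a _ => Submodule.smul_mem _ _ (Submodule.subset_span ⟨_, rfl⟩)

theorem matricize_injective (n : Finset ι) : Function.Injective (matricize H n) := by
  rw [injective_iff_map_eq_zero]
  intro u hu
  refine (dense_span_elem H).eq_zero_of_inner_left (𝕜 := ℝ) ?_
  intro z hz
  induction hz using Submodule.span_induction with
  | mem z hz =>
    obtain ⟨x, rfl⟩ := hz
    rw [← mul_elem H n, ← inner_matricize, hu]; simp
  | zero => simp
  | add x y _ _ hx hy => simp [inner_add_right, hx, hy]
  | smul r x _ hx => simp [real_inner_smul_right, hx]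

theorem isCompactOperator_rankOne {E F : Type*} [NormedAddCommGroup E] [InnerProductSpace ℝ E]
    [NormedAddCommGroup F] [InnerProductSpace ℝ F] (w : F) (v : E) :
    IsCompactOperator (InnerProductSpace.rankOne ℝ w v) := by
  rw [InnerProductSpace.rankOne_def']
  have h : IsCompactOperator (innerSL ℝ v) := isCompactOperator_of_locallyCompactSpace_dom _
  exact h.clm_comp (ContinuousLinearMap.toSpanSingleton ℝ w)

theorem isCompactOperator_matricize (n : Finset ι) (u : HilbertTensor H) :
    IsCompactOperator (matricize H n u) := by
  have hc : IsClosed {u | IsCompactOperator (matricize H n u)} :=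
    isClosed_setOfPred_isCompactOperator.preimage (matricize H n).continuous
  have hs : (Submodule.span ℝ (Set.range (elem : (∀ i, H i) → HilbertTensor H)) :
      Set (HilbertTensor H)) ⊆ {u | IsCompactOperator (matricize H n u)} := by
    intro z hz
    induction hz using Submodule.span_induction with
    | mem z hz =>
      obtain ⟨x, rfl⟩ := hz
      rw [← mul_elem H n]
      simp only [Set.mem_ofPred_eq, matricize_mul]
      exact isCompactOperator_rankOne _ _
    | zero => simpa using isCompactOperator_zero
    | add x y _ _ hx hy => simpa using hx.add hy
    | smul r x _ hx => simpa using hx.smul r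
  exact (dense_span_elem H).closure_eq ▸ hc.closure_subset_iff.2 hs <| trivial

/-- The inverse of the (injective) matricization, which turns an operator in the range of the
matricization back into a tensor. -/
def invMatricize (n : Finset ι) : (CoPart H n →L[ℝ] Part H n) → HilbertTensor H :=
  Function.invFun (matricize H n)

theorem invMatricize_matricize (n : Finset ι) (u : HilbertTensor H) :
    invMatricize H n (matricize H n u) = u :=
  Function.leftInverse_invFun (matricize_injective H n) u

theorem nonempty_svd_matricize (n : Finset ι) (u : HilbertTensor H) :
    Nonempty (SVD (matricize H n u)) :=
  SVD.nonempty_of_isCompactOperator _ (isCompactOperator_matricize H n u)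

/-- Soft thresholding of the singular values of the matricization of a tensor with respect to `n`. -/
def softThreshold (n : Finset ι) (α : ℝ) (u : HilbertTensor H) : HilbertTensor H :=
  invMatricize H n (softThresholdOp α (matricize H n u))

end HilbertTensor

/-- A binary dimension tree with root `a`: either a leaf `{i}`, or a root that is the disjoint union
of its two sons, each of which carries a binary dimension tree. -/
inductive DimensionTree {ι : Type*} [DecidableEq ι] : Finset ι → Type _
  | leaf (i : ι) : DimensionTree {i}
  | node {a b : Finset ι} (hab : Disjoint a b) (l : DimensionTree a) (r : DimensionTree b) :
      DimensionTree (a ∪ b)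

namespace DimensionTree

variable {ι : Type*} [DecidableEq ι]

/-- The nodes of a dimension tree, as sets of modes. -/
def nodes : {a : Finset ι} → DimensionTree a → Finset (Finset ι)
  | _, leaf i => {{i}}
  | _, @node _ _ a b _ l r => insert (a ∪ b) (l.nodes ∪ r.nodes)

/-- The edges `{n, [n]}` of a dimension tree for the full set of modes, where `n` runs through the
nodes other than the root and `[n]` is the complement of `n`. -/
def edges [Fintype ι] (T : DimensionTree (Finset.univ : Finset ι)) : Finset (Sym2 (Finset ι)) :=
  (T.nodes.erase Finset.univ).image fun n => s(n, nᶜ)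

/-- An enumeration `{n t, [n t]}`, `t = 1, …, E`, of the `E` edges of a dimension tree. -/
structure EdgeEnumeration [Fintype ι] (T : DimensionTree (Finset.univ : Finset ι)) where
  /-- The set `n t`, which determines the `t`-th matricization. -/
  n : Fin T.edges.card → Finset ι
  bijOn : Set.BijOn (fun t => s(n t, (n t)ᶜ)) Set.univ (T.edges : Set (Sym2 (Finset ι)))

end DimensionTree

end

/-! Write `M_t` for the `t`-th matricization. If `M_s(u) = ∑ σ_k ⟨v_k, ·⟩ w_k`, soft thresholding
multiplies each term by `c_k = s_α(σ_k)/σ_k ∈ [0,1]`. Since `M_s(u)* w_k = σ_k v_k` and `M_s(u) v_k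
= σ_k w_k`, the thresholded tensor is `(A ⊗ id) u` with `A = ∑ c_k ⟨w_k, ·⟩ w_k` a contraction on
the modes in `n_s`, and equally `(id ⊗ B) u` with `B = ∑ c_k ⟨v_k, ·⟩ v_k` a contraction on the
modes outside `n_s`. The nodes of the tree are laminar, so some side of edge `s` is disjoint from
some side of edge `t` (`disjoint_or_disjoint`). The contraction on that side of `s` commutes with
contracting `u` against a vector on that side of `t` (`IsSlot.commute`). Hence `‖M_t(·) a‖` for all
`a`, or `‖M_t(·)* b‖` for all `b`, does not increase (`norm_adjoint_softThreshold_le`), and the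
min-max principle (`σ_le_σ_of_norm_le`) gives the inequality of singular values. -/

noncomputable section
set_option linter.unusedSectionVars false
open scoped TensorProduct InnerProductSpace
open Filter Topology

/-! ### Singular values: the two halves of the min-max principle. -/

namespace SVD

variable {E F : Type*} [NormedAddCommGroup E] [InnerProductSpace ℝ E]
  [NormedAddCommGroup F] [InnerProductSpace ℝ F]

/-- The adjoint of a singular value decomposition. -/
def adjoint [CompleteSpace E] [CompleteSpace F] {X : E →L[ℝ] F} (D : SVD X) :
    SVD (ContinuousLinearMap.adjoint X) where
  σ := D.σ
  left := D.right
  right := D.left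
  nonneg := D.nonneg
  antitone := D.antitone
  orthonormal_left := D.orthonormal_right
  orthonormal_right := D.orthonormal_left
  hasSum := by
    have h := D.hasSum.map (ContinuousLinearMap.adjoint (𝕜 := ℝ) (E := E) (F := F))
      (ContinuousLinearMap.adjoint (𝕜 := ℝ) (E := E) (F := F)).continuous
    refine h.congr_fun fun k => ?_
    simp [InnerProductSpace.adjoint_rankOne]

theorem hasSum_apply {X : E →L[ℝ] F} (D : SVD X) (a : E) :
    HasSum (fun k => (D.σ k * ⟪D.right k, a⟫_ℝ) • D.left k) (X a) := by
  have h := D.hasSum.map (ContinuousLinearMap.apply ℝ F a)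
    (ContinuousLinearMap.apply ℝ F a).continuous
  simpa [Function.comp_def, mul_smul] using h

theorem inner_left_apply {X : E →L[ℝ] F} (D : SVD X) (a : E) {k : ℕ} (hk : D.σ k ≠ 0) :
    ⟪D.left k, X a⟫_ℝ = D.σ k * ⟪D.right k, a⟫_ℝ := by
  have h := (D.hasSum_apply a).map (innerSL ℝ (D.left k)) (innerSL ℝ (D.left k)).continuous
  refine h.unique ?_
  convert hasSum_single k ?_ using 1
  · have := D.orthonormal_left.1 ⟨k, hk⟩
    simp only at this
    simp [real_inner_smul_right, this]
  · intro j hj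
    by_cases hj0 : D.σ j = 0
    · simp [hj0]
    · have := D.orthonormal_left.2 (i := ⟨k, hk⟩) (j := ⟨j, hj0⟩)
        (fun h => hj (congrArg Subtype.val h).symm)
      simp only at this
      simp [real_inner_smul_right, this]

theorem apply_right {X : E →L[ℝ] F} (D : SVD X) {k : ℕ} (hk : D.σ k ≠ 0) :
    X (D.right k) = D.σ k • D.left k := by
  refine (D.hasSum_apply (D.right k)).unique ?_
  convert hasSum_single k ?_ using 1
  · have := D.orthonormal_right.1 ⟨k, hk⟩
    simp only at this
    simp [this]
  · intro j hj
    by_cases hj0 : D.σ j = 0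
    · simp [hj0]
    · have := D.orthonormal_right.2 (i := ⟨j, hj0⟩) (j := ⟨k, hk⟩)
        (fun h => hj (congrArg Subtype.val h))
      simp only at this
      simp [this]

/-- Upper half of min-max: only the terms with `k ≥ n` survive, their coefficients are at most `D.σ
n`, and Bessel bounds what remains. -/
theorem norm_apply_le {X : E →L[ℝ] F} (D : SVD X) {n : ℕ} {a : E}
    (ha : ∀ k < n, ⟪D.right k, a⟫_ℝ = 0) : ‖X a‖ ≤ D.σ n * ‖a‖ := by
  refine le_of_tendsto' (D.hasSum_apply a).norm fun t => ?_
  -- Orthonormality is available only over nonzero singular values; the discarded terms vanish.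
  have e1 : ∑ k ∈ t, (D.σ k * ⟪D.right k, a⟫_ℝ) • D.left k =
      ∑ k ∈ t.subtype (fun k => D.σ k ≠ 0), (D.σ k * ⟪D.right k, a⟫_ℝ) • D.left k := by
    rw [Finset.sum_subtype_eq_sum_filter (s := t) (p := fun k => D.σ k ≠ 0)
      (fun k => (D.σ k * ⟪D.right k, a⟫_ℝ) • D.left k), Finset.sum_filter_of_ne]
    intro k _ h h0
    simp [h0] at h
  rw [e1, ← sq_le_sq₀ (norm_nonneg _) (mul_nonneg (D.nonneg n) (norm_nonneg _)),
    ← real_inner_self_eq_norm_sq, D.orthonormal_left.inner_sum]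
  calc _ ≤ ∑ k ∈ t.subtype (fun k => D.σ k ≠ 0), D.σ n ^ 2 * ‖⟪D.right k, a⟫_ℝ‖ ^ 2 := by
        refine Finset.sum_le_sum fun k _ => ?_
        simp only [conj_trivial, Real.norm_eq_abs, sq_abs]
        rcases lt_or_ge (k : ℕ) n with hk | hk
        · simp [ha _ hk]
        · have := pow_le_pow_left₀ (D.nonneg k) (D.antitone hk) 2
          nlinarith [sq_nonneg ⟪D.right k, a⟫_ℝ]
    _ ≤ D.σ n ^ 2 * ‖a‖ ^ 2 := by
        rw [← Finset.mul_sum]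
        exact mul_le_mul_of_nonneg_left (D.orthonormal_right.sum_inner_products_le a)
          (by positivity)
    _ = _ := by ring

/-- Lower half of min-max, by counting dimensions: `n` orthogonality conditions on the span of the
`n + 1` leading right singular vectors leave a nonzero vector, and on that span `X` stretches by at
least `D.σ n`. -/
theorem exists_le_norm_apply {X : E →L[ℝ] F} (D : SVD X) {n : ℕ} (hn : D.σ n ≠ 0)
    (v : ℕ → E) : ∃ a : E, a ≠ 0 ∧ (∀ k < n, ⟪v k, a⟫_ℝ = 0) ∧ D.σ n * ‖a‖ ≤ ‖X a‖ := by
  have hpos : 0 < D.σ n := lt_of_le_of_ne (D.nonneg n) hn.symm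
  have hne : ∀ k : Fin (n + 1), D.σ k ≠ 0 := fun k =>
    (hpos.trans_le (D.antitone (Nat.lt_succ_iff.1 k.2))).ne'
  have hinj : Function.Injective (fun k : Fin (n + 1) => (⟨k, hne k⟩ : {k // D.σ k ≠ 0})) :=
    fun j k h => Fin.ext (congrArg Subtype.val h)
  have hr : Orthonormal ℝ (fun k : Fin (n + 1) => D.right k) := D.orthonormal_right.comp _ hinj
  have hl : Orthonormal ℝ (fun k : Fin (n + 1) => D.left k) := D.orthonormal_left.comp _ hinj
  let f : (Fin (n + 1) → ℝ) →ₗ[ℝ] (Fin n → ℝ) :=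
    { toFun := fun c k => ⟪v k, ∑ j, c j • D.right j⟫_ℝ
      map_add' := fun c c' => by ext k; simp [add_smul, Finset.sum_add_distrib, inner_add_right]
      map_smul' := fun r c => by
        ext k
        simp only [Pi.smul_apply, smul_eq_mul, mul_smul, ← Finset.smul_sum, real_inner_smul_right,
          RingHom.id_apply] }
  obtain ⟨c, hc, hc0⟩ := (Submodule.ne_bot_iff _).1
    (LinearMap.ker_ne_bot_of_finrank_lt (f := f) (by simp))
  set a := ∑ j, c j • D.right (j : Fin (n + 1)) with ha
  have hac : ∀ k : Fin (n + 1), ⟪D.right k, a⟫_ℝ = c k := fun k => hr.inner_right_fintype c k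
  have hnorm : ‖a‖ ^ 2 = ∑ k, c k ^ 2 := by
    rw [← real_inner_self_eq_norm_sq, ha, hr.inner_sum]
    simp [sq]
  refine ⟨a, ?_, fun k hk => congrFun (LinearMap.mem_ker.1 hc) ⟨k, hk⟩, ?_⟩
  · intro h0
    exact hc0 (funext fun k => by rw [← hac, h0, inner_zero_right]; rfl)
  · rw [← sq_le_sq₀ (mul_nonneg (D.nonneg n) (norm_nonneg _)) (norm_nonneg _), mul_pow, hnorm,
      Finset.mul_sum]
    refine le_trans (Finset.sum_le_sum fun k _ => ?_)
      (hl.sum_inner_products_le (s := Finset.univ) (X a))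
    rw [D.inner_left_apply a (hne k), hac, Real.norm_eq_abs, sq_abs, mul_pow]
    exact mul_le_mul_of_nonneg_right
      (pow_le_pow_left₀ hpos.le (D.antitone (Nat.lt_succ_iff.1 k.2)) 2) (sq_nonneg _)

/-- Singular values are monotone in the quadratic form `a ↦ ‖X a‖ ^ 2`. -/
theorem σ_le_σ_of_norm_le {G : Type*} [NormedAddCommGroup G] [InnerProductSpace ℝ G]
    {X : E →L[ℝ] F} {Y : E →L[ℝ] G} (D : SVD X) (D' : SVD Y)
    (h : ∀ a, ‖Y a‖ ≤ ‖X a‖) (n : ℕ) : D'.σ n ≤ D.σ n := by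
  by_cases hn : D'.σ n = 0
  · rw [hn]; exact D.nonneg n
  -- The test vector comes from the top singular space of `Y` but is orthogonal to the first `n`
  -- right singular vectors of `X`, so both halves of min-max apply to it.
  · obtain ⟨a, ha0, hv, ha⟩ := D'.exists_le_norm_apply hn D.right
    exact le_of_mul_le_mul_right ((ha.trans (h a)).trans (D.norm_apply_le hv))
      (norm_pos_iff.2 ha0)

/-- The terms of the convergent series have operator norm `D.σ k`. Hence only finitely many singular
values exceed a given `α > 0`. -/
theorem tendsto_σ {X : E →L[ℝ] F} (D : SVD X) : Tendsto D.σ atTop (𝓝 0) := by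
  have h := D.hasSum.summable.tendsto_atTop_zero.norm
  simp only [norm_zero] at h
  refine h.congr fun k => ?_
  by_cases hk : D.σ k = 0
  · simp [hk]
  · have h1 := D.orthonormal_left.1 ⟨k, hk⟩
    have h2 := D.orthonormal_right.1 ⟨k, hk⟩
    simp only at h1 h2
    simp [norm_smul, h1, h2, abs_of_nonneg (D.nonneg k)]

end SVD

theorem Submodule.induction_of_dense_span {P : Type*} [NormedAddCommGroup P] [NormedSpace ℝ P]
    {s : Set P} (hs : Dense (Submodule.span ℝ s : Set P)) {C : P → Prop}
    (hC : IsClosed {p | C p}) (mem : ∀ p ∈ s, C p) (zero : C 0)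
    (add : ∀ p q, C p → C q → C (p + q)) (smul : ∀ (r : ℝ) p, C p → C (r • p)) (p : P) :
    C p := by
  have h : (Submodule.span ℝ s : Set P) ⊆ {p | C p} := fun z hz =>
    Submodule.span_induction (p := fun z _ => C z) mem zero
      (fun x y _ _ hx hy => add x y hx hy) (fun r x _ hx => smul r x hx) hz
  exact hC.closure_subset_iff.2 h (hs p)

/-! ### Operators acting on a single tensor factor. -/

section SlotOp

variable {P Q R S G : Type*} [NormedAddCommGroup P] [InnerProductSpace ℝ P]
  [NormedAddCommGroup Q] [InnerProductSpace ℝ Q] [CompleteSpace Q]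
  [NormedAddCommGroup R] [InnerProductSpace ℝ R]
  [NormedAddCommGroup S] [InnerProductSpace ℝ S] [CompleteSpace S]
  [NormedAddCommGroup G] [InnerProductSpace ℝ G] [CompleteSpace G]

/-- For a bilinear map `β` that realizes `G` as a tensor product of `P` and `Q`, the operator
`⟪p', ·⟫ p ⊗ id` on `G`. -/
def slotOp (β : P →L[ℝ] Q →L[ℝ] G) (p p' : P) : G →L[ℝ] G :=
  (β p).comp (ContinuousLinearMap.adjoint (β p'))

/-- The bilinear map `β` is compatible with the inner products, as a tensor product is. -/
def IsTensorMap (β : P →L[ℝ] Q →L[ℝ] G) : Prop :=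
  ∀ p p' q q', ⟪β p q, β p' q'⟫_ℝ = ⟪p, p'⟫_ℝ * ⟪q, q'⟫_ℝ

theorem slotOp_apply (β : P →L[ℝ] Q →L[ℝ] G) (p p' : P) (u : G) :
    slotOp β p p' u = β p (ContinuousLinearMap.adjoint (β p') u) := rfl

theorem continuous_slotOp (β : P →L[ℝ] Q →L[ℝ] G) :
    Continuous fun x : P × P => slotOp β x.1 x.2 := by
  unfold slotOp
  have : Continuous (ContinuousLinearMap.adjoint (𝕜 := ℝ) (E := Q) (F := G)) :=
    LinearIsometryEquiv.continuous _
  fun_prop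

theorem slotOp_add_left (β : P →L[ℝ] Q →L[ℝ] G) (p q p' : P) :
    slotOp β (p + q) p' = slotOp β p p' + slotOp β q p' := by
  ext u; simp [slotOp_apply]

theorem slotOp_smul_left (β : P →L[ℝ] Q →L[ℝ] G) (r : ℝ) (p p' : P) :
    slotOp β (r • p) p' = r • slotOp β p p' := by
  ext u; simp [slotOp_apply]

theorem slotOp_add_right (β : P →L[ℝ] Q →L[ℝ] G) (p p' q' : P) :
    slotOp β p (p' + q') = slotOp β p p' + slotOp β p q' := by
  ext u; simp [slotOp_apply]

theorem slotOp_smul_right (β : P →L[ℝ] Q →L[ℝ] G) (r : ℝ) (p p' : P) :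
    slotOp β p (r • p') = r • slotOp β p p' := by
  ext u; simp [slotOp_apply]

/-- `slotOp` is continuous and bilinear in its two vectors, so commuting with `T` is a closed linear
condition on each; density is used in one vector at a time. -/
theorem commute_slotOp_of_dense (β : P →L[ℝ] Q →L[ℝ] G) {s : Set P}
    (hs : Dense (Submodule.span ℝ s : Set P)) {T : G →L[ℝ] G}
    (h : ∀ p ∈ s, ∀ p' ∈ s, Commute T (slotOp β p p')) (p p' : P) :
    Commute T (slotOp β p p') := by
  have hc := continuous_slotOp β
  have h1 : ∀ p ∈ s, ∀ p', Commute T (slotOp β p p') := by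
    intro p hp
    refine Submodule.induction_of_dense_span hs ?_ (h p hp) ?_ ?_ ?_
    · exact isClosed_eq
        (continuous_const.mul (hc.comp (Continuous.prodMk_right p)))
        ((hc.comp (Continuous.prodMk_right p)).mul continuous_const)
    · simp [slotOp]
    · intro a b ha hb; rw [slotOp_add_right]; exact ha.add_right hb
    · intro r a ha; rw [slotOp_smul_right]; exact ha.smul_right r
  refine Submodule.induction_of_dense_span (C := fun p => Commute T (slotOp β p p')) hs ?_
    (fun p hp => h1 p hp p') ?_ ?_ ?_ p
  · exact isClosed_eq
      (continuous_const.mul (hc.comp (Continuous.prodMk_left p')))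
      ((hc.comp (Continuous.prodMk_left p')).mul continuous_const)
  · simp [slotOp]
  · intro a b ha hb; rw [slotOp_add_left]; exact ha.add_right hb
  · intro r a ha; rw [slotOp_smul_left]; exact ha.smul_right r

namespace IsTensorMap

variable {β : P →L[ℝ] Q →L[ℝ] G} {γ : R →L[ℝ] S →L[ℝ] G}

theorem flip [CompleteSpace P] (hβ : IsTensorMap β) : IsTensorMap β.flip := fun p p' q q' => by
  rw [ContinuousLinearMap.flip_apply, ContinuousLinearMap.flip_apply, hβ, mul_comm]

theorem adjoint_apply (hβ : IsTensorMap β) (p p' : P) (q : Q) :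
    ContinuousLinearMap.adjoint (β p') (β p q) = ⟪p, p'⟫_ℝ • q := by
  refine ext_inner_right ℝ fun q' => ?_
  rw [ContinuousLinearMap.adjoint_inner_left, hβ, real_inner_smul_left]

theorem norm_apply (hβ : IsTensorMap β) (p : P) (q : Q) : ‖β p q‖ = ‖p‖ * ‖q‖ := by
  rw [← sq_eq_sq₀ (norm_nonneg _) (by positivity), mul_pow, ← real_inner_self_eq_norm_sq,
    ← real_inner_self_eq_norm_sq, ← real_inner_self_eq_norm_sq, hβ]

/-- The maps `β (v k)` are isometries with mutually orthogonal ranges, so the `slotOp β (v k) (v k)`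
are orthogonal projections onto orthogonal subspaces, and weights in `[0,1]` give a contraction. -/
theorem norm_sum_slotOp_apply_le {ι : Type*} (hβ : IsTensorMap β) {v : ι → P}
    (hv : Orthonormal ℝ v) (t : Finset ι) {c : ι → ℝ} (hc0 : ∀ k, 0 ≤ c k) (hc1 : ∀ k, c k ≤ 1)
    (u : G) : ‖∑ k ∈ t, c k • slotOp β (v k) (v k) u‖ ≤ ‖u‖ := by
  classical
  set b : ι → Q := fun k => ContinuousLinearMap.adjoint (β (v k)) u with hb
  have key : ∀ c : ι → ℝ, ‖∑ k ∈ t, c k • β (v k) (b k)‖ ^ 2 = ∑ k ∈ t, c k ^ 2 * ‖b k‖ ^ 2 := by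
    intro c
    rw [← real_inner_self_eq_norm_sq, sum_inner]
    refine Finset.sum_congr rfl fun k hk => ?_
    rw [inner_sum, Finset.sum_eq_single k]
    · rw [real_inner_smul_left, real_inner_smul_right, hβ, real_inner_self_eq_norm_sq,
        real_inner_self_eq_norm_sq, hv.1]
      ring
    · intro j _ hj
      rw [real_inner_smul_left, real_inner_smul_right, hβ, hv.2 hj.symm]
      ring
    · exact fun h => absurd hk h
  have hinner : ⟪u, ∑ k ∈ t, β (v k) (b k)⟫_ℝ = ∑ k ∈ t, ‖b k‖ ^ 2 := by
    rw [inner_sum]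
    refine Finset.sum_congr rfl fun k _ => ?_
    rw [← ContinuousLinearMap.adjoint_inner_left, real_inner_self_eq_norm_sq]
  -- With `p` the unweighted sum, `⟪u, p⟫ = ‖p‖ ^ 2 = ∑ ‖b k‖ ^ 2`; now expand `0 ≤ ‖u - p‖ ^ 2`.
  have hbessel : ∑ k ∈ t, ‖b k‖ ^ 2 ≤ ‖u‖ ^ 2 := by
    have h1 := norm_sub_sq_real u (∑ k ∈ t, β (v k) (b k))
    have h2 := key fun _ => 1
    simp only [one_smul, one_pow, one_mul] at h2
    rw [hinner, h2] at h1
    nlinarith [sq_nonneg ‖u - ∑ k ∈ t, β (v k) (b k)‖]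
  rw [← sq_le_sq₀ (norm_nonneg _) (norm_nonneg _)]
  refine (key c).trans_le (le_trans (Finset.sum_le_sum fun k _ => ?_) hbessel)
  exact mul_le_of_le_one_left (sq_nonneg _) (pow_le_one₀ (hc0 k) (hc1 k))

/-- A contraction on one tensor factor does not increase the norm of the contraction of a tensor
with a vector of a factor on which it does not act. -/
theorem norm_adjoint_sum_slotOp_le {ι : Type*} (hβ : IsTensorMap β) (hγ : IsTensorMap γ)
    (hcomm : ∀ p p' r r', Commute (slotOp β p p') (slotOp γ r r')) {v : ι → P}
    (hv : Orthonormal ℝ v) (t : Finset ι) {c : ι → ℝ} (hc0 : ∀ k, 0 ≤ c k) (hc1 : ∀ k, c k ≤ 1)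
    (u : G) (r : R) :
    ‖ContinuousLinearMap.adjoint (γ r) (∑ k ∈ t, c k • slotOp β (v k) (v k) u)‖ ≤
      ‖ContinuousLinearMap.adjoint (γ r) u‖ := by
  by_cases hr : r = 0
  · simp [hr]
  have hr' : 0 < ‖r‖ := norm_pos_iff.2 hr
  -- Since `‖r‖ * ‖(γ r)* w‖ = ‖slotOp γ r r w‖`, both sides become norms in `G`, where the
  -- contraction can be commuted past `slotOp γ r r`.
  refine le_of_mul_le_mul_left ?_ hr'
  rw [← hγ.norm_apply, ← hγ.norm_apply, ← slotOp_apply, ← slotOp_apply]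
  refine le_of_eq_of_le ?_ (hβ.norm_sum_slotOp_apply_le hv t hc0 hc1 (slotOp γ r r u))
  rw [map_sum]
  congr 1
  refine Finset.sum_congr rfl fun k _ => ?_
  rw [map_smul]
  exact congrArg (c k • ·) (DFunLike.congr_fun (hcomm (v k) (v k) r r).eq u).symm

end IsTensorMap

end SlotOp

/-! ### Commuting actions on disjoint sets of modes. -/

namespace HilbertTensor

variable {ι : Type*} [Fintype ι] [DecidableEq ι] (H : ι → Type*) [∀ i, NormedAddCommGroup (H i)]
  [∀ i, InnerProductSpace ℝ (H i)]

theorem isTensorMap_mul (n : Finset ι) : IsTensorMap (mul H n) :=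
  fun p p' q q' => inner_mul_mul H n p p' q q'

theorem inner_elem {κ : Type*} [Fintype κ] {K : κ → Type*} [∀ i, NormedAddCommGroup (K i)]
    [∀ i, InnerProductSpace ℝ (K i)] (x y : ∀ i, K i) :
    ⟪elem x, elem y⟫_ℝ = ∏ i, ⟪x i, y i⟫_ℝ := by
  rw [elem, elem, UniformSpace.Completion.inner_coe, AlgTensor.inner_tprod]

theorem mul_elem_elem (n : Finset ι) (x z : ∀ i, H i) :
    mul H n (elem fun i => x i) (elem fun i => z i) = elem (n.piecewise x z) := by
  rw [elem, elem, mul_coe, mergeAlg_tprod, elem]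
  rfl

/-- A family on the subtype extends by zero, so restrictions of global families suffice; this allows
`IsSlot` to index its generators by families over all modes. -/
theorem dense_span_elem_restrict (p : ι → Prop) [DecidablePred p] [Fintype {i // p i}] :
    Dense (Submodule.span ℝ (Set.range fun x : ∀ i, H i => elem fun i : {i // p i} => x i) :
      Set (HilbertTensor fun i : {i // p i} => H i)) := by
  refine (dense_span_elem _).mono (Submodule.span_mono ?_)
  rintro _ ⟨x, rfl⟩
  exact ⟨fun i => if h : p i then x ⟨i, h⟩ else 0,
    congrArg elem (funext fun i => dif_pos i.2)⟩

/-- A tensor product map of `P` and `Q` onto the Hilbert tensor product, in which `P` takes the place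
of the partial tensor product over the modes in `n`. -/
structure IsSlot {P Q : Type*} [NormedAddCommGroup P] [InnerProductSpace ℝ P]
    [NormedAddCommGroup Q] [InnerProductSpace ℝ Q] [CompleteSpace Q]
    (β : P →L[ℝ] Q →L[ℝ] HilbertTensor H) (n : Finset ι) : Prop where
  isTensorMap : IsTensorMap β
  exists_elem : ∃ e : (∀ i, H i) → P, Dense (Submodule.span ℝ (Set.range e) : Set P) ∧
    ∀ x y z, slotOp β (e x) (e y) (elem z) =
      (∏ i ∈ n, ⟪z i, y i⟫_ℝ) • elem (n.piecewise x z)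

theorem isSlot_mul (n : Finset ι) : IsSlot H (mul H n) n where
  isTensorMap := isTensorMap_mul H n
  exists_elem := by
    refine ⟨fun x => elem fun i => x i, dense_span_elem_restrict H (· ∈ n), fun x y z => ?_⟩
    rw [← mul_elem H n z, slotOp_apply, (isTensorMap_mul H n).adjoint_apply, map_smul,
      mul_elem_elem, inner_elem]
    congr 1
    exact (Finset.prod_subtype n (fun _ => Iff.rfl) (fun i => ⟪z i, y i⟫_ℝ)).symm

/-- The factor `CoPart H n` is indexed by `i ∉ n`, not by membership in `nᶜ`; the abstract space `P`
in `IsSlot` absorbs the difference, so both sides of an edge are treated alike. -/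
theorem isSlot_mul_flip (n : Finset ι) : IsSlot H (mul H n).flip nᶜ where
  isTensorMap := (isTensorMap_mul H n).flip
  exists_elem := by
    refine ⟨fun x => elem fun i => x i, dense_span_elem_restrict H (· ∉ n), fun x y z => ?_⟩
    rw [← mul_elem H n z, slotOp_apply, ← ContinuousLinearMap.flip_apply (mul H n),
      (isTensorMap_mul H n).flip.adjoint_apply, map_smul, ContinuousLinearMap.flip_apply,
      mul_elem_elem, inner_elem, Finset.piecewise_compl]
    congr 1
    exact (Finset.prod_subtype nᶜ (fun _ => Finset.mem_compl) (fun i => ⟪z i, y i⟫_ℝ)).symm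

variable {H}

/-- On elementary tensors each operator reads a scalar off its own modes and overwrites only those
modes. Disjointness makes the order irrelevant, and density extends this to all vectors. -/
theorem IsSlot.commute {P Q R S : Type*} [NormedAddCommGroup P] [InnerProductSpace ℝ P]
    [NormedAddCommGroup Q] [InnerProductSpace ℝ Q] [CompleteSpace Q]
    [NormedAddCommGroup R] [InnerProductSpace ℝ R]
    [NormedAddCommGroup S] [InnerProductSpace ℝ S] [CompleteSpace S]
    {β : P →L[ℝ] Q →L[ℝ] HilbertTensor H} {γ : R →L[ℝ] S →L[ℝ] HilbertTensor H}
    {n m : Finset ι} (hβ : IsSlot H β n) (hγ : IsSlot H γ m) (hnm : Disjoint n m)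
    (p p' : P) (r r' : R) : Commute (slotOp β p p') (slotOp γ r r') := by
  obtain ⟨e, he, hβe⟩ := hβ.exists_elem
  obtain ⟨f, hf, hγf⟩ := hγ.exists_elem
  refine commute_slotOp_of_dense γ hf ?_ r r'
  rintro _ ⟨x', rfl⟩ _ ⟨y', rfl⟩
  refine (commute_slotOp_of_dense β he ?_ p p').symm
  rintro _ ⟨x, rfl⟩ _ ⟨y, rfl⟩
  refine ContinuousLinearMap.ext_on (dense_span_elem H) ?_
  rintro _ ⟨z, rfl⟩
  simp only [mul_apply_eq_comp, hβe, hγf, map_smul, smul_smul]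
  have h1 : ∏ i ∈ m, ⟪n.piecewise x z i, y' i⟫_ℝ = ∏ i ∈ m, ⟪z i, y' i⟫_ℝ :=
    Finset.prod_congr rfl fun i hi => by
      rw [Finset.piecewise_eq_of_notMem _ _ _ (Finset.disjoint_right.1 hnm hi)]
  have h2 : ∏ i ∈ n, ⟪m.piecewise x' z i, y i⟫_ℝ = ∏ i ∈ n, ⟪z i, y i⟫_ℝ :=
    Finset.prod_congr rfl fun i hi => by
      rw [Finset.piecewise_eq_of_notMem _ _ _ (Finset.disjoint_left.1 hnm hi)]
  have h3 : m.piecewise x' (n.piecewise x z) = n.piecewise x (m.piecewise x' z) := by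
    ext i
    by_cases hm : i ∈ m
    · simp [hm, Finset.disjoint_right.1 hnm hm]
    · by_cases hn : i ∈ n <;> simp [hm, hn]
  rw [h1, h2, h3, mul_comm]

/-! ### Soft thresholding as a contraction on either side of an edge. -/

variable (H)

theorem matricize_apply (n : Finset ι) (u : HilbertTensor H) (a : CoPart H n) :
    matricize H n u a = ContinuousLinearMap.adjoint ((mul H n).flip a) u := rfl

/-- Together with `matricize_apply`, this presents a matricization and its adjoint alike as
contractions of `u` with a vector in one slot, so one norm estimate serves both. -/
theorem adjoint_matricize_apply (n : Finset ι) (u : HilbertTensor H) (b : Part H n) :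
    ContinuousLinearMap.adjoint (matricize H n u) b =
      ContinuousLinearMap.adjoint (mul H n b) u := by
  refine ext_inner_right ℝ fun a => ?_
  rw [ContinuousLinearMap.adjoint_inner_left, ContinuousLinearMap.adjoint_inner_left,
    real_inner_comm, inner_matricize]

theorem softThresholdReal_zero (x : ℝ) : softThresholdReal 0 x = x := by
  rw [softThresholdReal, sub_zero, max_eq_left (abs_nonneg x), mul_comm]
  rcases lt_trichotomy x 0 with h | rfl | h
  · simp [Real.sign_of_neg h, abs_of_neg h]
  · simp
  · simp [Real.sign_of_pos h, abs_of_pos h]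

theorem softThresholdReal_eq_mul {α x : ℝ} (hα : 0 ≤ α) (hx : 0 < x) :
    ∃ c, 0 ≤ c ∧ c ≤ 1 ∧ softThresholdReal α x = c * x := by
  refine ⟨max (x - α) 0 / x, by positivity, ?_, ?_⟩
  · rw [div_le_one hx]
    exact max_le (by linarith) hx.le
  · rw [softThresholdReal, Real.sign_of_pos hx, abs_of_pos hx, one_mul,
      div_mul_cancel₀ _ hx.ne']

theorem softThresholdReal_eq_zero {α x : ℝ} (hx : 0 ≤ x) (h : x ≤ α) :
    softThresholdReal α x = 0 := by
  rw [softThresholdReal, abs_of_nonneg hx, max_eq_right (by linarith), mul_zero]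

/-- The case `α = 0` stands apart because the thresholded series may then have infinitely many
nonzero terms. -/
theorem softThreshold_zero (n : Finset ι) (u : HilbertTensor H) : softThreshold H n 0 u = u := by
  have h := nonempty_svd_matricize H n u
  rw [softThreshold, softThresholdOp, dif_pos h]
  simp only [softThresholdReal_zero]
  rw [h.some.hasSum.tsum_eq, invMatricize_matricize]

theorem softThreshold_eq_sum (n : Finset ι) {α : ℝ} (hα : 0 < α) (u : HilbertTensor H) :
    ∃ (D : SVD (matricize H n u)) (t : Finset {k // D.σ k ≠ 0}),
      softThreshold H n α u =
        ∑ k ∈ t, softThresholdReal α (D.σ k) • mul H n (D.left k) (D.right k) := by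
  have h := nonempty_svd_matricize H n u
  set D := h.some with hD
  obtain ⟨N, hN⟩ := eventually_atTop.1 (D.tendsto_σ.eventually_le_const hα)
  refine ⟨D, (Finset.range N).subtype _, ?_⟩
  rw [softThreshold, softThresholdOp, dif_pos h, ← hD, tsum_eq_sum (s := Finset.range N)]
  · rw [Finset.sum_subtype_eq_sum_filter (s := Finset.range N) (p := fun k => D.σ k ≠ 0)
      (fun k => softThresholdReal α (D.σ k) • mul H n (D.left k) (D.right k)),
      Finset.sum_filter_of_ne]
    -- `invMatricize` is a true inverse only on the range of `matricize`; the finite sum of rank-one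
    -- operators is exhibited as the matricization of a finite sum of tensors.
    · rw [← invMatricize_matricize H n (∑ k ∈ _, _)]
      simp only [map_sum, map_smul, matricize_mul]
    · intro k _ hk h0
      simp [h0, softThresholdReal] at hk
  · intro k hk
    rw [softThresholdReal_eq_zero (D.nonneg k) (hN k (by simpa using hk)), zero_smul]

/-- Soft thresholding with respect to `n` acts as a contraction on the modes in `n`, and equally as
a contraction on the modes in the complement of `n`. -/
theorem norm_adjoint_softThreshold_le (n m : Finset ι) {α : ℝ} (hα : 0 ≤ α) (u : HilbertTensor H)
    (hnm : Disjoint n m ∨ Disjoint nᶜ m) {R S : Type*} [NormedAddCommGroup R]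
    [InnerProductSpace ℝ R] [NormedAddCommGroup S] [InnerProductSpace ℝ S] [CompleteSpace S]
    {γ : R →L[ℝ] S →L[ℝ] HilbertTensor H} (hγ : IsSlot H γ m) (r : R) :
    ‖ContinuousLinearMap.adjoint (γ r) (softThreshold H n α u)‖ ≤
      ‖ContinuousLinearMap.adjoint (γ r) u‖ := by
  rcases hα.eq_or_lt with rfl | hα
  · rw [softThreshold_zero]
  obtain ⟨D, t, ht⟩ := softThreshold_eq_sum H n hα u
  choose c hc0 hc1 hc using fun k : {k // D.σ k ≠ 0} =>
    softThresholdReal_eq_mul hα.le (lt_of_le_of_ne (D.nonneg k) k.2.symm)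
  rcases hnm with hnm | hnm
  -- Contracting `u` with the left vector gives `σ k` times the right vector, so each thresholded
  -- term is `c k` times the projection of `u` in the `n` slot.
  · have e : softThreshold H n α u =
        ∑ k ∈ t, c k • slotOp (mul H n) (D.left k) (D.left k) u := by
      rw [ht]
      refine Finset.sum_congr rfl fun k _ => ?_
      rw [slotOp_apply, ← adjoint_matricize_apply, hc, mul_smul]
      have := D.adjoint.apply_right k.2
      simp only [SVD.adjoint] at this
      rw [this, map_smul]
    rw [e]
    exact (isTensorMap_mul H n).norm_adjoint_sum_slotOp_le hγ.isTensorMap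
      ((isSlot_mul H n).commute hγ hnm) D.orthonormal_left t hc0 hc1 u r
  -- The mirror image: contracting with the right vector gives `σ k` times the left one.
  · have e : softThreshold H n α u =
        ∑ k ∈ t, c k • slotOp (mul H n).flip (D.right k) (D.right k) u := by
      rw [ht]
      refine Finset.sum_congr rfl fun k _ => ?_
      rw [slotOp_apply, ← matricize_apply, hc, mul_smul, D.apply_right k.2, map_smul,
        ContinuousLinearMap.flip_apply]
    rw [e]
    exact (isTensorMap_mul H n).flip.norm_adjoint_sum_slotOp_le hγ.isTensorMap
      ((isSlot_mul_flip H n).commute hγ hnm) D.orthonormal_right t hc0 hc1 u r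

/-- If the thresholding can be placed on modes disjoint from `m`, the adjoints are compared, as they
contract `u` over `m` and have the same singular values; if on modes disjoint from `mᶜ`, the
matricizations themselves are. -/
theorem singularValue_softThreshold_le (n m : Finset ι)
    (hnm : (Disjoint n m ∨ Disjoint nᶜ m) ∨ (Disjoint n mᶜ ∨ Disjoint nᶜ mᶜ))
    {α : ℝ} (hα : 0 ≤ α) (u : HilbertTensor H) (i : ℕ) :
    singularValue (matricize H m (softThreshold H n α u)) i ≤
      singularValue (matricize H m u) i := by
  have h := nonempty_svd_matricize H m u
  have h' := nonempty_svd_matricize H m (softThreshold H n α u)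
  rw [singularValue, singularValue, dif_pos h, dif_pos h']
  rcases hnm with hnm | hnm
  · refine h.some.adjoint.σ_le_σ_of_norm_le h'.some.adjoint (fun b => ?_) i
    rw [adjoint_matricize_apply, adjoint_matricize_apply]
    exact norm_adjoint_softThreshold_le H n m hα u hnm (isSlot_mul H m) b
  · refine h.some.σ_le_σ_of_norm_le h'.some (fun a => ?_) i
    exact norm_adjoint_softThreshold_le H n mᶜ hα u hnm (isSlot_mul_flip H m) a

end HilbertTensor

/-! ### Combinatorics of the edges of a dimension tree. -/

namespace DimensionTree

variable {ι : Type*} [DecidableEq ι]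

theorem subset_of_mem_nodes {a : Finset ι} (T : DimensionTree a) {n : Finset ι}
    (hn : n ∈ T.nodes) : n ⊆ a := by
  induction T with
  | leaf i => simp [nodes] at hn; simp [hn]
  | node hab l r ihl ihr =>
    simp only [nodes, Finset.mem_insert, Finset.mem_union] at hn
    rcases hn with rfl | hn | hn
    · exact subset_rfl
    · exact (ihl hn).trans Finset.subset_union_left
    · exact (ihr hn).trans Finset.subset_union_right

/-- The nodes of a dimension tree form a laminar family. -/
theorem laminar {a : Finset ι} (T : DimensionTree a) {n m : Finset ι} (hn : n ∈ T.nodes)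
    (hm : m ∈ T.nodes) : Disjoint n m ∨ n ⊆ m ∨ m ⊆ n := by
  induction T with
  | leaf i => simp [nodes] at hn hm; simp [hn, hm]
  | node hab l r ihl ihr =>
    have hn' := subset_of_mem_nodes (.node hab l r) hn
    have hm' := subset_of_mem_nodes (.node hab l r) hm
    simp only [nodes, Finset.mem_insert, Finset.mem_union] at hn hm
    rcases hn with rfl | hn | hn
    · exact .inr (.inr hm')
    · rcases hm with rfl | hm | hm
      · exact .inr (.inl hn')
      · exact ihl hn hm
      · exact .inl (hab.mono (l.subset_of_mem_nodes hn) (r.subset_of_mem_nodes hm))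
    · rcases hm with rfl | hm | hm
      · exact .inr (.inl hn')
      · exact .inl (hab.symm.mono (r.subset_of_mem_nodes hn) (l.subset_of_mem_nodes hm))
      · exact ihr hn hm

/-- Edges are unordered pairs, so an enumeration may select either side as its representative. -/
theorem EdgeEnumeration.exists_node [Fintype ι] {T : DimensionTree (Finset.univ : Finset ι)}
    (e : T.EdgeEnumeration) (t : Fin T.edges.card) : ∃ m ∈ T.nodes, e.n t = m ∨ e.n t = mᶜ := by
  obtain ⟨m, hm, h⟩ := Finset.mem_image.1 (Finset.mem_coe.1 (e.bijOn.mapsTo (Set.mem_univ t)))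
  refine ⟨m, Finset.mem_of_mem_erase hm, ?_⟩
  rcases Sym2.eq_iff.1 h with h | h
  · exact .inl h.1.symm
  · exact .inr h.2.symm

/-- Laminarity suffices, since an inclusion `n ⊆ m` says that `n` and `mᶜ` are disjoint. The
four-fold alternative is invariant under complementing either set, so the chosen representatives do
not matter. -/
theorem EdgeEnumeration.disjoint_or_disjoint [Fintype ι]
    {T : DimensionTree (Finset.univ : Finset ι)} (e : T.EdgeEnumeration)
    (s t : Fin T.edges.card) :
    (Disjoint (e.n s) (e.n t) ∨ Disjoint (e.n s)ᶜ (e.n t)) ∨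
      (Disjoint (e.n s) (e.n t)ᶜ ∨ Disjoint (e.n s)ᶜ (e.n t)ᶜ) := by
  obtain ⟨n, hn, hs⟩ := e.exists_node s
  obtain ⟨m, hm, ht⟩ := e.exists_node t
  have h : Disjoint n m ∨ Disjoint n mᶜ ∨ Disjoint nᶜ m := by
    rcases T.laminar hn hm with h | h | h
    · exact .inl h
    · exact .inr (.inl (LE.le.disjoint_compl_right h))
    · exact .inr (.inr (LE.le.disjoint_compl_right h).symm)
  rcases hs with hs | hs <;> rcases ht with ht | ht <;> simp only [hs, ht, compl_compl] <;> tauto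

end DimensionTree

end
theorem lemma3p2 {d : ℕ} (hd : 2 ≤ d) (H : Fin d → Type*) [∀ i, NormedAddCommGroup (H i)]
    [∀ i, InnerProductSpace ℝ (H i)] [∀ i, CompleteSpace (H i)]
    [∀ i, TopologicalSpace.SeparableSpace (H i)]
    (T : DimensionTree (Finset.univ : Finset (Fin d))) (e : T.EdgeEnumeration)
    (u : HilbertTensor H) (s t : Fin T.edges.card) (α : ℝ) (hα : 0 ≤ α) (i : ℕ) :
    singularValue (HilbertTensor.matricize H (e.n t) u) i ≥
      singularValue
        (HilbertTensor.matricize H (e.n t) (HilbertTensor.softThreshold H (e.n s) α u)) i := by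
  exact HilbertTensor.singularValue_softThreshold_le H _ _ (e.disjoint_or_disjoint s t) hα u i
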